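/- Let $G=(V,E)$ be a finite tree and $v\in V$. Let $d$ be the graph distance. For nodes $u,v$, let $H(u,v)$ be the hitting time: the expected number of steps before the simple random walk on $G$ started at $u$ (which moves at each step to a uniformly chosen neighbour of its current node) first visits $v$, with $H(v,v)=0$. Define the closeness centrality and the random-walk closeness centrality of $v$ by $$C_v(G)=\Bigl(\sum_{u\in V\setminus\{v\}} d(u,v)\Bigr)^{-1},\qquad RWC_v(G)=\Bigl(\sum_{u\in V\setminus\{v\}} H(u,v)\Bigr)^{-1},$$ and for $u\in V$ let $T_u^v=\{w\in V : d(w,v)=d(w,u)+d(u,v)\}$ be the set of nodes $w$ such that the path from $v$ to $w$ goes through $u$. Then all hitting times $H(u,v)$, $u\in V$, are finite, and $$C_v^{-1}(G)=\sum_{u\in V\setminus\{v\}}|T_u^v|,\qquad RWC_v^{-1}(G)=\sum_{u\in V\setminus\{v\}}|T_u^v|\,\bigl(2|T_u^v|-1\bigr).$$ (If $|V|=1$, all the sums are empty, and the convention $0^{-1}=0$ makes both equalities read $0=0$.) -/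

import Mathlib

open MeasureTheory ProbabilityTheory
open scoped ENNReal

namespace TreeCentrality

variable {V : Type*} [Fintype V]

open Classical in
/-- One step of the random walk from `u`: the uniform distribution on the neighbours of `u`, so
that each neighbour has probability `1 / deg u`. An isolated node has no edge to follow, and the
walk rests there. -/
noncomputable def step (G : SimpleGraph V) (u : V) : PMF V :=
  if h : (G.neighborFinset u).Nonempty then PMF.uniformOfFinset (G.neighborFinset u) h
  else PMF.pure u

section Walk

variable [MeasurableSpace V] [MeasurableSingletonClass V]

/-- The transition kernel of the random walk on `G`. -/
noncomputable def stepKernel (G : SimpleGraph V) : Kernel V V :=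
  Kernel.ofFunOfCountable fun u => (step G u).toMeasure

instance (G : SimpleGraph V) : IsMarkovKernel (stepKernel G) :=
  ⟨fun u => inferInstanceAs (IsProbabilityMeasure (step G u).toMeasure)⟩

/-- The conditional law of the position at time `t + 1`, given the positions at times `0, …, t`:
it depends on the position at time `t` only. -/
noncomputable def historyKernel (G : SimpleGraph V) (t : ℕ) :
    Kernel (Π _ : Finset.Iic t, V) V :=
  (stepKernel G).comap (fun x => x ⟨t, Finset.mem_Iic.2 le_rfl⟩) (measurable_pi_apply _)

instance (G : SimpleGraph V) (t : ℕ) : IsMarkovKernel (historyKernel G t) := by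
  unfold historyKernel; infer_instance

/-- The law of the random walk `(v₀, v₁, …)` on `G` started at `v₀ = u`, as a probability measure
on the space of all node sequences. -/
noncomputable def walkLaw (G : SimpleGraph V) (u : V) : Measure (ℕ → V) :=
  Kernel.traj (X := fun _ => V) (historyKernel G) 0 (fun _ => u)

end Walk

/-- The first time `t ≥ 0` at which the sequence `ω` is at `v` (`⊤` if it never is). -/
noncomputable def firstVisit (v : V) (ω : ℕ → V) : ℕ∞ :=
  hittingAfter (fun (t : ℕ) (ω : ℕ → V) => ω t) {v} 0 ω

/-- The hitting time `H(u, v)`: the expected number of steps of the random walk started at `u`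
before `v` is visited, as a value in `[0, ∞]`. -/
noncomputable def hittingTime (G : SimpleGraph V) (u v : V) : ℝ≥0∞ :=
  letI : MeasurableSpace V := ⊤
  ∫⁻ ω, (firstVisit v ω : ℝ≥0∞) ∂(walkLaw G u)

variable [DecidableEq V]

/-- Closeness centrality of `v` in the connected graph `G`. -/
noncomputable def closeness (G : SimpleGraph V) (v : V) : ℝ :=
  (∑ u ∈ Finset.univ.erase v, (G.dist u v : ℝ))⁻¹

/-- Random-Walk Closeness centrality of `v` in the connected graph `G`. -/
noncomputable def rwCloseness (G : SimpleGraph V) (v : V) : ℝ :=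
  (∑ u ∈ Finset.univ.erase v, (hittingTime G u v).toReal)⁻¹

/-- The set `T_u^v` of the nodes to which the path from `v` goes through `u`. -/
noncomputable def subtree (G : SimpleGraph V) (v u : V) : Finset V :=
  {w | G.dist w v = G.dist w u + G.dist u v}

end TreeCentrality

/-! Root the tree at `v`. Both `d(u,v)` and `H(u,v)` are sums of weights over the nodes `w ≠ v` on
the path from `u` to `v`: weight `1` for the distance and `2|T_w| - 1`, the expected time to go from
`w` to its parent, for the hitting time. Summing over `u` and exchanging the sums counts the weight
of `w` once for each node of `T_w` (`sum_pathSum`), which yields both identities. The formula for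
`H` is checked, not derived: the path sum solves the first-step equations
(`sum_treeHittingTime_neighbor`), and any finite solution vanishing at `v` is the expected hitting
time (`lintegral_firstVisit_eq`), so finiteness comes with it. -/

namespace TreeCentrality

/-! ### Distances, parents and subtrees in a rooted tree -/

section Tree

variable {V : Type*} {G : SimpleGraph V}

lemma exists_adj_dist_add_one (hG : G.Connected) {u w : V} (h : u ≠ w) :
    ∃ y, G.Adj u y ∧ G.dist u w = G.dist y w + 1 := by
  obtain ⟨p, hp⟩ := hG.exists_walk_length_eq_dist u w
  cases p with
  | nil => exact absurd rfl h
  | @cons _ y _ hy q =>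
    refine ⟨y, hy, ?_⟩
    have h1 := SimpleGraph.dist_le q
    have h2 := hG.dist_triangle (u := u) (v := y) (w := w)
    have h3 := SimpleGraph.dist_eq_one_iff_adj.2 hy
    rw [SimpleGraph.Walk.length_cons] at hp
    omega

/-- Uniqueness of the parent: shortest walks to `v` through `p` and through `q` are both paths,
hence equal. -/
lemma eq_of_adj_of_dist_eq_add_one (hG : G.IsTree) {u v p q : V} (hp : G.Adj u p)
    (hpd : G.dist u v = G.dist p v + 1) (hq : G.Adj u q) (hqd : G.dist u v = G.dist q v + 1) :
    p = q := by
  obtain ⟨a, ha⟩ := hG.connected.exists_walk_length_eq_dist p v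
  obtain ⟨b, hb⟩ := hG.connected.exists_walk_length_eq_dist q v
  have h1 : (SimpleGraph.Walk.cons hp a).IsPath :=
    SimpleGraph.Walk.isPath_of_length_eq_dist _ (by simp [ha, hpd])
  have h2 : (SimpleGraph.Walk.cons hq b).IsPath :=
    SimpleGraph.Walk.isPath_of_length_eq_dist _ (by simp [hb, hqd])
  have h3 := congrArg SimpleGraph.Walk.snd ((hG.existsUnique_path u v).unique h1 h2)
  simpa using h3

variable [Fintype V]

lemma mem_subtree {v u w : V} :
    w ∈ subtree G v u ↔ G.dist w v = G.dist w u + G.dist u v := by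
  simp [subtree]

lemma self_mem_subtree (v u : V) : u ∈ subtree G v u := by simp [mem_subtree]

lemma root_mem_subtree (hG : G.Connected) {v w : V} : v ∈ subtree G v w ↔ w = v := by
  rw [mem_subtree, SimpleGraph.dist_self, G.dist_comm (u := v), ← hG.dist_eq_zero_iff]
  omega

lemma dist_le_of_mem_subtree {v u w : V} (h : w ∈ subtree G v u) : G.dist u v ≤ G.dist w v := by
  rw [mem_subtree] at h; omega

/-- If `w ≠ u` lies on the path from `u` to `v`, a first step from `u` towards `w` also approaches
`v`, so it leads to the parent `p`. -/
lemma mem_subtree_iff_parent (hG : G.IsTree) {u v p w : V} (hp : G.Adj u p)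
    (hpd : G.dist u v = G.dist p v + 1) :
    u ∈ subtree G v w ↔ w = u ∨ p ∈ subtree G v w := by
  simp only [mem_subtree]
  have hc := hG.connected
  have h1 := SimpleGraph.dist_eq_one_iff_adj.2 hp
  constructor
  · intro h
    by_cases hw : w = u
    · exact Or.inl hw
    right
    obtain ⟨y, hy, hyd⟩ := exists_adj_dist_add_one hc (Ne.symm hw)
    have h2 := hc.dist_triangle (u := y) (v := w) (w := v)
    have h3 := hc.dist_triangle (u := u) (v := y) (w := v)
    have h4 := SimpleGraph.dist_eq_one_iff_adj.2 hy
    have : p = y := eq_of_adj_of_dist_eq_add_one hG hp hpd hy (by omega)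
    subst this
    omega
  · rintro (rfl | h)
    · simp
    · have h2 := hc.dist_triangle (u := u) (v := p) (w := w)
      have h3 := hc.dist_triangle (u := u) (v := w) (w := v)
      omega

lemma notMem_subtree_of_dist_lt {u v p : V} (h : G.dist p v < G.dist u v) :
    p ∉ subtree G v u := fun hp => absurd (dist_le_of_mem_subtree hp) (by omega)

lemma card_subtree_pos (v u : V) : 0 < (subtree G v u).card :=
  Finset.card_pos.2 ⟨u, self_mem_subtree v u⟩

open Classical in
/-- The neighbours of `u` that are farther from `v` than `u` is. -/
noncomputable def children (G : SimpleGraph V) (v u : V) : Finset V :=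
  {c | G.Adj u c ∧ G.dist c v = G.dist u v + 1}

lemma mem_children {v u c : V} :
    c ∈ children G v u ↔ G.Adj u c ∧ G.dist c v = G.dist u v + 1 := by
  simp [children]

/-! ### Sums along paths to the root -/

variable [DecidableEq V]

/-- The sum of the weights `g w` over the nodes `w ≠ v` on the path from `v` to `u`. -/
noncomputable def pathSum (G : SimpleGraph V) (v : V) (g : V → ℕ) (u : V) : ℕ :=
  ∑ w ∈ Finset.univ.erase v, if u ∈ subtree G v w then g w else 0

lemma pathSum_root (hG : G.Connected) (v : V) (g : V → ℕ) : pathSum G v g v = 0 := by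
  refine Finset.sum_eq_zero fun w hw => if_neg ?_
  rw [root_mem_subtree hG]
  exact Finset.ne_of_mem_erase hw

lemma pathSum_eq_add_parent (hG : G.IsTree) {u v p : V} (g : V → ℕ) (hp : G.Adj u p)
    (hpd : G.dist u v = G.dist p v + 1) : pathSum G v g u = g u + pathSum G v g p := by
  have huv : u ≠ v := by rintro rfl; simp at hpd
  have h : ∀ w, (if u ∈ subtree G v w then g w else 0) =
      (if w = u then g w else 0) + if p ∈ subtree G v w then g w else 0 := by
    intro w
    have h1 := mem_subtree_iff_parent hG (w := w) hp hpd
    by_cases hw : w = u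
    · subst hw
      simp [self_mem_subtree, notMem_subtree_of_dist_lt (G := G) (show G.dist p v < G.dist w v by omega)]
    · simp [h1, hw]
  simp only [pathSum, h, Finset.sum_add_distrib]
  simp [huv]

lemma sum_pathSum (hG : G.Connected) (v : V) (g : V → ℕ) :
    ∑ u ∈ Finset.univ.erase v, pathSum G v g u =
      ∑ w ∈ Finset.univ.erase v, (subtree G v w).card * g w := by
  simp only [pathSum]
  rw [Finset.sum_comm]
  refine Finset.sum_congr rfl fun w hw => ?_
  have hv : v ∉ subtree G v w := by
    rw [root_mem_subtree hG]; exact Finset.ne_of_mem_erase hw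
  rw [← Finset.sum_filter, Finset.sum_const, smul_eq_mul]
  congr 2
  ext x
  simp only [Finset.mem_filter, Finset.mem_erase, Finset.mem_univ, and_true, and_iff_right_iff_imp]
  rintro h rfl
  exact hv h

lemma pathSum_one (hG : G.IsTree) (v u : V) : pathSum G v (fun _ => 1) u = G.dist u v := by
  induction h : G.dist u v generalizing u with
  | zero =>
    rw [hG.connected.dist_eq_zero_iff] at h
    subst h
    exact pathSum_root hG.connected _ _
  | succ n ih =>
    have huv : u ≠ v := by rintro rfl; simp at h
    obtain ⟨p, hp, hpd⟩ := exists_adj_dist_add_one hG.connected huv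
    rw [pathSum_eq_add_parent hG _ hp hpd, ih p (by omega), add_comm]

/-- This is the partition of `T_u` into `{u}` and the subtrees of the children. Since `w` is a child
of `u` exactly when its parent `p` is `u`, the identity for `w` reduces to that for `p`. -/
lemma ite_mem_subtree_eq_sum_children (hG : G.IsTree) {v u : V} (huv : u ≠ v) (w : V) :
    (if w ∈ subtree G v u then 1 else 0) =
      (if w = u then 1 else 0) + ∑ c ∈ children G v u, if w ∈ subtree G v c then 1 else 0 := by
  have hc := hG.connected
  induction h : G.dist w v generalizing w with
  | zero =>
    rw [hc.dist_eq_zero_iff] at h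
    subst h
    rw [Finset.sum_eq_zero]
    · simp [root_mem_subtree hc, huv, huv.symm]
    · intro c hcm
      rw [if_neg]
      rw [root_mem_subtree hc]
      rintro rfl
      simp [mem_children] at hcm
  | succ n ih =>
    have hwv : w ≠ v := by rintro rfl; simp at h
    obtain ⟨p, hp, hpd⟩ := exists_adj_dist_add_one hc hwv
    have hsplit : ∀ x, (if w ∈ subtree G v x then 1 else 0) =
        (if w = x then 1 else 0) + if p ∈ subtree G v x then 1 else 0 := by
      intro x
      have h1 := mem_subtree_iff_parent hG (w := x) hp hpd
      by_cases hw : w = x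
      · subst hw
        simp [self_mem_subtree,
          notMem_subtree_of_dist_lt (G := G) (show G.dist p v < G.dist w v by omega)]
      · simp [h1, hw, Ne.symm hw]
    have hchild : w ∈ children G v u ↔ p = u := by
      rw [mem_children]
      constructor
      · rintro ⟨ha, hd⟩
        exact eq_of_adj_of_dist_eq_add_one hG hp hpd ha.symm hd
      · rintro rfl
        exact ⟨hp.symm, hpd⟩
    simp only [hsplit, Finset.sum_add_distrib, Finset.sum_ite_eq, hchild]
    rw [ih p (by omega)]

lemma card_subtree_eq (hG : G.IsTree) {v u : V} (huv : u ≠ v) :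
    (subtree G v u).card = 1 + ∑ c ∈ children G v u, (subtree G v c).card := by
  have h : ∀ x, (subtree G v x).card = ∑ w, if w ∈ subtree G v x then 1 else 0 := by
    intro x; simp
  simp only [h]
  rw [Finset.sum_comm (s := children G v u), Finset.sum_congr rfl
    fun w _ => ite_mem_subtree_eq_sum_children hG huv w, Finset.sum_add_distrib]
  simp

/-! ### First-step equations for the candidate hitting time -/

/-- The value of the hitting time from `u` to `v` in a tree. -/
noncomputable def treeHittingTime (G : SimpleGraph V) (v u : V) : ℕ :=
  pathSum G v (fun w => 2 * (subtree G v w).card - 1) u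

open Classical in
-- The first-step equation multiplied by the degree, so that it lives in `ℕ`. Relative to `u`, a
-- child `c` contributes `2|T_c| - 1` and the parent `-(2|T_u| - 1)`; with the degree these cancel
-- because `|T_u| = 1 + ∑ |T_c|`.
lemma sum_treeHittingTime_neighbor (hG : G.IsTree) {v u : V} (huv : u ≠ v) :
    (G.neighborFinset u).card + ∑ x ∈ G.neighborFinset u, treeHittingTime G v x =
      (G.neighborFinset u).card * treeHittingTime G v u := by
  obtain ⟨p, hp, hpd⟩ := exists_adj_dist_add_one hG.connected huv
  have hpc : p ∉ children G v u := by
    rw [mem_children]; omega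
  have hN : G.neighborFinset u = insert p (children G v u) := by
    ext x
    simp only [SimpleGraph.mem_neighborFinset, Finset.mem_insert, mem_children]
    constructor
    · intro hx
      rcases hG.dist_eq_dist_add_one_of_adj v hx with h | h
      · rw [G.dist_comm (u := v), G.dist_comm (u := v)] at h
        exact Or.inl (eq_of_adj_of_dist_eq_add_one hG hx h hp hpd)
      · rw [G.dist_comm (u := v), G.dist_comm (u := v)] at h
        exact Or.inr ⟨hx, h⟩
    · rintro (rfl | h)
      · exact hp
      · exact h.1
  rw [hN, Finset.sum_insert hpc, Finset.card_insert_of_notMem hpc]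
  have h1 : treeHittingTime G v u = _ := pathSum_eq_add_parent hG _ hp hpd
  -- The `+ 1` absorbs the truncated subtraction in `2|T_c| - 1`.
  have h2 : ∑ c ∈ children G v u, (treeHittingTime G v c + 1) =
      ∑ c ∈ children G v u, (2 * (subtree G v c).card + treeHittingTime G v u) := by
    refine Finset.sum_congr rfl fun c hc => ?_
    rw [mem_children] at hc
    have h3 : treeHittingTime G v c = _ := pathSum_eq_add_parent hG _ hc.1.symm hc.2
    have h4 := card_subtree_pos (G := G) v c
    rw [h3]
    simp only [treeHittingTime]
    omega
  have h5 := card_subtree_eq hG huv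
  simp only [Finset.sum_add_distrib, ← Finset.mul_sum, Finset.sum_const, smul_eq_mul,
    mul_one] at h2
  change _ = _ + treeHittingTime G v p at h1
  rw [add_mul, one_mul]
  omega

end Tree

end TreeCentrality

namespace TreeCentrality

/-! ### Expected hitting times from first-step equations -/

section Walk

variable {V : Type*}

/-- The node sequences that do not visit `v` up to time `t`. -/
def avoid (v : V) (t : ℕ) : Set (ℕ → V) := {ω | ∀ i ≤ t, ω i ≠ v}

/-- The tail-sum formula: the first visit time is the number of times `t` by which `v` is still
unvisited. -/
lemma firstVisit_eq_tsum (v : V) (ω : ℕ → V) :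
    (firstVisit v ω : ℝ≥0∞) = ∑' t, (avoid v t).indicator 1 ω := by
  classical
  have hset : ∑' t, (avoid v t).indicator (1 : (ℕ → V) → ℝ≥0∞) ω =
      ({t | ω ∈ avoid v t} : Set ℕ).encard := by
    rw [← ENNReal.tsum_set_one, tsum_subtype {t | ω ∈ avoid v t} (fun _ => (1 : ℝ≥0∞))]
    refine tsum_congr fun t => ?_
    simp [Set.indicator_apply]
  rw [hset]
  congr 1
  unfold firstVisit
  by_cases h : ∃ j, ω j = v
  · have hfind : {i : ℕ | 0 ≤ i ∧ ω i ∈ ({v} : Set V)} = {i | ω i = v} := by ext; simp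
    rw [hittingAfter_def]
    simp only
    rw [if_pos (by simpa using h), hfind]
    have hs : {t | ω ∈ avoid v t} = Set.Iio (sInf {i | ω i = v}) := by
      ext t
      simp only [avoid, Set.mem_ofPred_eq, Set.mem_Iio]
      constructor
      · intro ht
        by_contra! hc
        exact ht _ hc (Nat.sInf_mem (s := {i | ω i = v}) h)
      · intro ht i hi hiv
        exact absurd (Nat.sInf_le (s := {i | ω i = v}) hiv) (by omega)
    rw [hs, ← Finset.coe_Iio, Set.encard_coe_eq_coe_finsetCard, Nat.card_Iio]
    rfl
  · push Not at h
    have hs : {t | ω ∈ avoid v t} = Set.univ := by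
      ext t; simp [avoid, h]
    rw [hs, Set.encard_univ, ENat.card_eq_top_of_infinite]
    exact hittingAfter_eq_top_iff.2 (by simpa using h)

variable [MeasurableSpace V] [MeasurableSingletonClass V]

lemma measurableSet_avoid (v : V) (t : ℕ) : MeasurableSet (avoid v t) := by
  have : avoid v t = ⋂ i ∈ Set.Iic t, (fun ω : ℕ → V => ω i) ⁻¹' {v}ᶜ := by
    ext ω; simp [avoid]
  rw [this]
  exact MeasurableSet.biInter (Set.to_countable _) fun i _ =>
    measurable_pi_apply i (measurableSet_singleton v).compl

variable [Fintype V]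

instance (G : SimpleGraph V) (u : V) : IsProbabilityMeasure (walkLaw G u) := by
  unfold walkLaw; infer_instance

/-- The Markov property of the random walk. -/
lemma lintegral_walkLaw_succ (G : SimpleGraph V) (u : V) (t : ℕ)
    {F : (Π _ : Finset.Iic t, V) → ℝ≥0∞} (hF : Measurable F) (g : V → ℝ≥0∞) :
    ∫⁻ ω, F (Preorder.frestrictLe t ω) * g (ω (t + 1)) ∂walkLaw G u =
      ∫⁻ ω, F (Preorder.frestrictLe t ω) * ∫⁻ y, g y ∂stepKernel G (ω t) ∂walkLaw G u := by
  have hg : Measurable g := measurable_of_countable g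
  have hm : Measurable fun z : (Π _ : Finset.Iic t, V) × V => F z.1 * g z.2 := by fun_prop
  have h1 := Kernel.partialTraj_compProd_eq_map_traj (X := fun _ => V) (κ := historyKernel G)
    (Nat.zero_le t) (x₀ := fun _ => u)
  have h2 := congrArg (fun μ => ∫⁻ z, F z.1 * g z.2 ∂μ) h1
  beta_reduce at h2
  rw [lintegral_map hm (by fun_prop), Measure.lintegral_compProd hm,
    ← Kernel.traj_map_frestrictLe_apply, lintegral_map hm.lintegral_kernel_prod_right'
      (by fun_prop)] at h2
  refine h2.symm.trans (lintegral_congr fun ω => ?_)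
  simp only
  rw [lintegral_const_mul _ hg]
  rfl

lemma lintegral_walkLaw_zero (G : SimpleGraph V) (u : V) (g : V → ℝ≥0∞) :
    ∫⁻ ω, g (ω 0) ∂walkLaw G u = g u := by
  have hg : Measurable g := measurable_of_countable g
  have h1 := Kernel.traj_map_frestrictLe_apply (X := fun _ => V) (κ := historyKernel G) 0 0
    (fun _ => u)
  have h2 := congrArg (fun μ => ∫⁻ z, g (z ⟨0, by simp⟩) ∂μ) h1
  beta_reduce at h2
  rw [lintegral_map (by fun_prop) (by fun_prop), Kernel.partialTraj_zero,
    Kernel.lintegral_deterministic' _ (by fun_prop)] at h2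
  exact h2

/-- A finite solution of the first-step equations is the expected hitting time. -/
theorem lintegral_firstVisit_eq (G : SimpleGraph V) (v : V) (f : V → ℝ≥0∞)
    (hfin : ∀ u, f u ≠ ⊤) (hv : f v = 0)
    (hf : ∀ u, u ≠ v → f u = 1 + ∫⁻ y, f y ∂stepKernel G u) (u : V) :
    ∫⁻ ω, (firstVisit v ω : ℝ≥0∞) ∂walkLaw G u = f u := by
  set μ := walkLaw G u
  -- `E t` is the expected time still predicted by `f` on the event that `v` is unvisited up to `t`;
  -- each step lowers it by `μ (avoid v t)`, so the sum of these probabilities telescopes.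
  let E : ℕ → ℝ≥0∞ := fun t => ∫⁻ ω, (avoid v t).indicator 1 ω * f (ω t) ∂μ
  have hind : ∀ t, Measurable ((avoid v t).indicator (1 : (ℕ → V) → ℝ≥0∞)) := fun t =>
    measurable_one.indicator (measurableSet_avoid v t)
  have hE0 : E 0 = f u := by
    rw [← lintegral_walkLaw_zero G u f]
    refine lintegral_congr fun ω => ?_
    by_cases h : ω 0 = v <;> simp [avoid, h, hv]
  have hstep : ∀ t, μ (avoid v t) + E (t + 1) = E t := by
    intro t
    let F : (Π _ : Finset.Iic t, V) → ℝ≥0∞ := {x | ∀ i, x i ≠ v}.indicator 1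
    have hFm : Measurable F := measurable_of_countable F
    have hF : ∀ ω : ℕ → V, F (Preorder.frestrictLe t ω) = (avoid v t).indicator 1 ω := by
      intro ω
      have hmem : Preorder.frestrictLe t ω ∈ {x : (Π _ : Finset.Iic t, V) | ∀ i, x i ≠ v} ↔
          ω ∈ avoid v t := by simp [avoid]
      by_cases h : ω ∈ avoid v t
      · simp only [F, Set.indicator_of_mem (hmem.2 h), Set.indicator_of_mem h, Pi.one_apply]
      · simp only [F, Set.indicator_of_notMem (mt hmem.1 h), Set.indicator_of_notMem h]
    -- As `f v = 0`, the condition at time `t + 1` can be dropped; what remains depends on the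
    -- history up to `t`, as the Markov property requires.
    have h1 : E (t + 1) = ∫⁻ ω, (avoid v t).indicator 1 ω * f (ω (t + 1)) ∂μ := by
      refine lintegral_congr fun ω => ?_
      by_cases h : ω (t + 1) = v
      · simp [h, hv]
      · congr 1
        have : ω ∈ avoid v (t + 1) ↔ ω ∈ avoid v t :=
          ⟨fun hω i hi => hω i (by omega), fun hω i hi => by
            rcases Nat.le_succ_iff.1 hi with h' | rfl
            exacts [hω i h', h]⟩
        by_cases hω : ω ∈ avoid v t
        · simp [hω, this.2 hω]
        · simp [hω, mt this.1 hω]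
    have h2 := lintegral_walkLaw_succ G u t hFm f
    simp only [hF] at h2
    rw [h1, h2, ← lintegral_indicator_one (measurableSet_avoid v t),
      ← lintegral_add_left (hind t)]
    refine lintegral_congr fun ω => ?_
    by_cases h : ω ∈ avoid v t
    · simp [h, hf (ω t) (h t le_rfl)]
    · simp [h]
  have hsum : ∀ n, ∑ t ∈ Finset.range n, μ (avoid v t) + E n = f u := by
    intro n
    induction n with
    | zero => simpa using hE0
    | succ n ih => rw [Finset.sum_range_succ, add_assoc, hstep, ih]
  have hle : ∑' t, μ (avoid v t) ≤ f u :=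
    ENNReal.tsum_le_of_sum_range_le fun n => (hsum n) ▸ le_self_add
  have hμ0 : Filter.Tendsto (fun n => μ (avoid v n)) Filter.atTop (nhds 0) :=
    ENNReal.tendsto_atTop_zero_of_tsum_ne_top (ne_top_of_le_ne_top (hfin u) hle)
  have hC : (∑ x, f x) ≠ ⊤ := ENNReal.sum_ne_top.2 fun x _ => hfin x
  -- The remainder vanishes: `f` is bounded by its finite total, and `μ (avoid v n)` tends to `0`
  -- because its series is at most `f u`.
  have hEle : ∀ n, E n ≤ (∑ x, f x) * μ (avoid v n) := by
    intro n
    rw [← lintegral_indicator_one (measurableSet_avoid v n), ← lintegral_const_mul _ (hind n)]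
    refine lintegral_mono fun ω => ?_
    beta_reduce
    rw [mul_comm]
    gcongr
    exact Finset.single_le_sum (f := f) (fun _ _ => zero_le) (Finset.mem_univ (ω n))
  have hE : Filter.Tendsto E Filter.atTop (nhds 0) := by
    refine tendsto_of_tendsto_of_tendsto_of_le_of_le tendsto_const_nhds ?_ (fun _ => zero_le) hEle
    simpa using ENNReal.Tendsto.const_mul hμ0 (Or.inr hC)
  have hlim := (ENNReal.tendsto_nat_tsum fun t => μ (avoid v t)).add hE
  simp only [hsum, add_zero] at hlim
  simp only [firstVisit_eq_tsum]
  rw [lintegral_tsum fun t => (hind t).aemeasurable]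
  simp only [lintegral_indicator_one (measurableSet_avoid v _)]
  exact tendsto_nhds_unique hlim tendsto_const_nhds |>.symm ▸ rfl

open Classical in
lemma card_mul_lintegral_stepKernel (G : SimpleGraph V) {u : V}
    (h : (G.neighborFinset u).Nonempty) (f : V → ℝ≥0∞) :
    ((G.neighborFinset u).card : ℝ≥0∞) * ∫⁻ y, f y ∂stepKernel G u =
      ∑ x ∈ G.neighborFinset u, f x := by
  change _ * ∫⁻ y, f y ∂(step G u).toMeasure = _
  rw [lintegral_fintype]
  simp only [PMF.toMeasure_apply_singleton _ _ (measurableSet_singleton _), step, dif_pos h,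
    PMF.uniformOfFinset_apply, mul_ite, mul_zero, Finset.sum_ite_mem, Finset.univ_inter]
  rw [← Finset.sum_mul, mul_comm, mul_assoc, ENNReal.inv_mul_cancel, mul_one]
  · exact Nat.cast_ne_zero.2 h.card_ne_zero
  · exact ENNReal.natCast_ne_top _

end Walk

variable {V : Type*} [Fintype V] [DecidableEq V]

theorem hittingTime_eq_treeHittingTime {G : SimpleGraph V} (hG : G.IsTree) (u v : V) :
    hittingTime G u v = treeHittingTime G v u := by
  classical
  let : MeasurableSpace V := ⊤
  refine lintegral_firstVisit_eq G v (fun x => (treeHittingTime G v x : ℝ≥0∞))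
    (fun x => ENNReal.natCast_ne_top _) (by simp [treeHittingTime, pathSum_root hG.connected])
    (fun x hx => ?_) u
  obtain ⟨p, hp, -⟩ := exists_adj_dist_add_one hG.connected hx
  have hne : (G.neighborFinset x).Nonempty := ⟨p, by simpa using hp⟩
  have h1 := card_mul_lintegral_stepKernel G hne fun y => (treeHittingTime G v y : ℝ≥0∞)
  have h2 := congrArg (Nat.cast : ℕ → ℝ≥0∞) (sum_treeHittingTime_neighbor hG hx)
  push_cast at h2
  rw [← h1] at h2
  have h0 : ((G.neighborFinset x).card : ℝ≥0∞) ≠ 0 :=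
    Nat.cast_ne_zero.2 hne.card_ne_zero
  refine (ENNReal.mul_right_inj h0 (ENNReal.natCast_ne_top _)).1 ?_
  rw [← h2, mul_add, mul_one]

end TreeCentrality

theorem mainTheorem10 {V : Type*} [Fintype V] [DecidableEq V] (G : SimpleGraph V)
    (hG : G.IsTree) (v : V) :
    (TreeCentrality.closeness G v)⁻¹ =
        ∑ u ∈ Finset.univ.erase v, ((TreeCentrality.subtree G v u).card : ℝ) ∧
      (∀ u : V, TreeCentrality.hittingTime G u v ≠ ⊤) ∧
      (TreeCentrality.rwCloseness G v)⁻¹ =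
        ∑ u ∈ Finset.univ.erase v,
          ((TreeCentrality.subtree G v u).card : ℝ) *
            (2 * ((TreeCentrality.subtree G v u).card : ℝ) - 1) := by
  have hH : ∀ u, TreeCentrality.hittingTime G u v = TreeCentrality.treeHittingTime G v u :=
    fun u => TreeCentrality.hittingTime_eq_treeHittingTime hG u v
  refine ⟨?_, fun u => (hH u).symm ▸ ENNReal.natCast_ne_top _, ?_⟩
  · have h := TreeCentrality.sum_pathSum hG.connected v fun _ => 1
    simp only [TreeCentrality.pathSum_one hG, mul_one] at h
    rw [TreeCentrality.closeness, inv_inv]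
    exact_mod_cast h
  · have h := TreeCentrality.sum_pathSum hG.connected v
      fun w => 2 * (TreeCentrality.subtree G v w).card - 1
    rw [TreeCentrality.rwCloseness, inv_inv]
    simp only [hH, ENNReal.toReal_natCast, ← Nat.cast_sum]
    refine (congrArg (Nat.cast : ℕ → ℝ) h).trans ?_
    rw [Nat.cast_sum]
    refine Finset.sum_congr rfl fun w _ => ?_
    -- Nonemptiness of `T_w` makes the natural subtraction in `2|T_w| - 1` agree with the real one.
    have := TreeCentrality.card_subtree_pos (G := G) v w
    rw [Nat.cast_mul, Nat.cast_sub (by omega)]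
    push_cast
    ring
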